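/- For integers $m, n \ge 1$ let the Kneser graph $\mathrm{KG}(n,m)$ be the graph whose vertices are the $n$-element subsets of $\{1,\dots,m\}$, with an edge between two vertices if and only if the corresponding sets are disjoint. Then for all integers $n \ge 1$ and $k \ge 0$ the chromatic number satisfies $$\chi(\mathrm{KG}(n,2n+k)) \ge k+2.$$ -/

import Mathlib

/-- The Kneser graph `KG(n, m)`: its vertices are the `n`-element subsets of an `m`-element set
(here `Fin m`), and two distinct vertices are adjacent iff the subsets are disjoint. For `1 ≤ n`
the requirement of distinctness is automatic; it only excludes the loop at `∅` when `n = 0`. -/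
def kneserGraph (n m : ℕ) : SimpleGraph {s : Finset (Fin m) // s.card = n} where
  Adj s t := s ≠ t ∧ Disjoint s.1 t.1
  symm := ⟨fun _ _ h => ⟨h.1.symm, h.2.symm⟩⟩
  loopless := ⟨fun _ h => h.1 rfl⟩

/-!
# The chromatic number of Kneser graphs

The lower bound `k + 2 ≤ χ(KG(n, 2n + k))` follows from a Tucker-type lemma on sign vectors
`x : Fin m → SignType`: for every antipodal `Bool`-valued labelling of the nonzero sign vectors
there is a maximal chain along which the label alternates. The number of those chains is shown to
be odd.
-/

open Finset Function

/-! ### Alternating chains and a Tucker lemma modulo 2 -/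

section SignVectors

variable {m : ℕ}

/-! A proper colouring with `c` colours gives sign vectors an antipodal label and a rank at most `2n
- 2 + c` that drops whenever deleting a coordinate changes the label (`kneserRank_update_lt`). A
parity count, passing from spheres to equators, yields a maximal chain with alternating labels
(`sum_altChains_initialSigns`). The rank strictly increases along its `m` nonzero vectors, so `m ≤
2n - 2 + c`; take `m = 2n + k`. -/

/-- The support of a sign vector. -/
def signSupport (x : Fin m → SignType) : Finset (Fin m) := {i | x i ≠ 0}

@[simp] lemma mem_signSupport {x : Fin m → SignType} {i : Fin m} :
    i ∈ signSupport x ↔ x i ≠ 0 := by simp [signSupport]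

lemma signSupport_neg (x : Fin m → SignType) : signSupport (-x) = signSupport x := by
  ext i; simp

lemma signSupport_update_zero (x : Fin m → SignType) (i : Fin m) :
    signSupport (update x i 0) = (signSupport x).erase i := by
  ext j
  by_cases h : j = i <;> simp [h]

lemma ne_zero_of_card_signSupport_pos {x : Fin m → SignType} (h : 0 < #(signSupport x)) :
    x ≠ 0 := by
  rintro rfl
  simp [signSupport] at h

/-- The number modulo 2 of chains of length `d` of sign vectors which start at `x`, go down by
deleting one coordinate at a time, and along which the labels `s` alternate starting from `b`. -/
def altChains (s : (Fin m → SignType) → Bool) : ℕ → Bool → (Fin m → SignType) → ZMod 2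
  | 0, _, _ => 1
  | d + 1, b, x => if s x = b then ∑ i ∈ signSupport x, altChains s d (!b) (update x i 0) else 0

/-- The boundary of a boundary vanishes: two coordinates can be deleted in either order. -/
lemma sum_sum_update_eq_zero (f : (Fin m → SignType) → ZMod 2) (x : Fin m → SignType) :
    ∑ i ∈ signSupport x, ∑ j ∈ signSupport (update x i 0),
      f (update (update x i 0) j 0) = 0 := by
  rw [Finset.sum_sigma']
  refine Finset.sum_involution (fun p _ => ⟨p.2, p.1⟩) ?_ ?_ ?_ ?_
  · rintro ⟨i, j⟩ h
    simp only [signSupport_update_zero, mem_sigma, mem_erase] at h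
    simp only [update_comm h.2.1]
    exact CharTwo.add_self_eq_zero _
  · rintro ⟨i, j⟩ h _ h'
    simp only [signSupport_update_zero, mem_sigma, mem_erase] at h
    simp only [Sigma.mk.injEq] at h'
    exact h.2.1 h'.1
  · rintro ⟨i, j⟩ h
    simp only [signSupport_update_zero, mem_sigma, mem_erase] at h ⊢
    exact ⟨h.2.2, h.2.1.symm, h.1⟩
  · rintro ⟨i, j⟩ h
    rfl

/-- The coboundary formula for alternating chains. -/
lemma altChains_add_altChains_not (s : (Fin m → SignType) → Bool) (d : ℕ) (b : Bool)
    (x : Fin m → SignType) :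
    altChains s (d + 1) b x + altChains s (d + 1) (!b) x =
      ∑ i ∈ signSupport x, altChains s d b (update x i 0) := by
  have key : ∑ i ∈ signSupport x, altChains s d (!b) (update x i 0) =
      ∑ i ∈ signSupport x, altChains s d b (update x i 0) := by
    rw [← CharTwo.add_eq_zero, ← Finset.sum_add_distrib]
    cases d with
    | zero => simp [altChains, CharTwo.add_self_eq_zero]
    | succ d =>
      -- By induction the two sums differ by a double boundary.
      rw [← sum_sum_update_eq_zero (altChains s d b) x]
      refine Finset.sum_congr rfl fun i _ => ?_
      rw [add_comm, altChains_add_altChains_not s d b]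
  by_cases h : s x = b
  · simpa [altChains, h] using key
  · have h' : s x = !b := by simpa [Bool.eq_not] using h
    simp [altChains, h']

lemma altChains_neg {s : (Fin m → SignType) → Bool} (hs : ∀ x, x ≠ 0 → s (-x) = !s x) (d : ℕ)
    (b : Bool) (x : Fin m → SignType) (hx : #(signSupport x) = d) :
    altChains s d b (-x) = altChains s d (!b) x := by
  induction d generalizing b x with
  | zero => rfl
  | succ d ih =>
    have hx0 : x ≠ 0 := ne_zero_of_card_signSupport_pos (by omega)
    simp only [altChains, hs x hx0, signSupport_neg, Bool.not_eq_eq_eq_not]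
    refine if_congr Iff.rfl (Finset.sum_congr rfl fun i hi => ?_) rfl
    rw [← ih (!b) (update x i 0)]
    · congr 1
      ext j
      by_cases h : j = i <;> simp [h]
    · rw [signSupport_update_zero, card_erase_of_mem hi, hx, Nat.add_sub_cancel]

/-- The sign vectors whose support consists of the first `d` coordinates. -/
def initialSigns (m d : ℕ) : Finset (Fin m → SignType) := {x | ∀ i, x i ≠ 0 ↔ i.val < d}

lemma mem_initialSigns {d : ℕ} {x : Fin m → SignType} :
    x ∈ initialSigns m d ↔ ∀ i, x i ≠ 0 ↔ i.val < d := by simp [initialSigns]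

lemma card_signSupport_of_mem_initialSigns {d : ℕ} (hd : d ≤ m) {x : Fin m → SignType}
    (hx : x ∈ initialSigns m d) : #(signSupport x) = d := by
  rw [mem_initialSigns] at hx
  have : signSupport x = ({i | i.val < d} : Finset (Fin m)) := by ext i; simp [hx]
  rw [this, Fin.card_filter_val_lt, min_eq_right hd]

lemma sum_initialSigns_succ {d : ℕ} (hd : d < m) (f : (Fin m → SignType) → ZMod 2) :
    ∑ x ∈ initialSigns m (d + 1), f x =
      ∑ x ∈ initialSigns m (d + 1) with x ⟨d, hd⟩ = 1, (f x + f (-x)) := by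
  rw [← Finset.sum_filter_add_sum_filter_not _ (fun x => x ⟨d, hd⟩ = 1), Finset.sum_add_distrib]
  congr 1
  refine Finset.sum_nbij' (fun x => -x) (fun x => -x) ?_ ?_ ?_ ?_ ?_
  · intro x hx
    simp only [mem_filter, mem_initialSigns] at hx ⊢
    refine ⟨by simpa using hx.1, ?_⟩
    have h0 := (hx.1 ⟨d, hd⟩).2 (by simp)
    have h1 := hx.2
    simp only [Pi.neg_apply]
    generalize x ⟨d, hd⟩ = a at h0 h1
    revert a; decide
  · intro x hx
    simp only [mem_filter, mem_initialSigns] at hx ⊢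
    refine ⟨by simpa using hx.1, ?_⟩
    simp only [Pi.neg_apply, hx.2]
    decide
  · intro x _; simp
  · intro x _; simp
  · intro x _; simp

/-- The facets of a closed hemisphere add up to its boundary sphere. -/
lemma sum_hemisphere_sum_update {d : ℕ} (hd : d < m) (f : (Fin m → SignType) → ZMod 2) :
    ∑ x ∈ initialSigns m (d + 1) with x ⟨d, hd⟩ = 1, ∑ i ∈ signSupport x, f (update x i 0) =
      ∑ x ∈ initialSigns m d, f x := by
  have hsupp : ∀ x ∈ (initialSigns m (d + 1)).filter (fun x => x ⟨d, hd⟩ = 1),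
      ∑ i ∈ signSupport x, f (update x i 0) =
        ∑ i : Fin m with i.val < d + 1, f (update x i 0) := by
    intro x hx
    rw [mem_filter, mem_initialSigns] at hx
    refine Finset.sum_congr ?_ fun _ _ => rfl
    ext i; simp [hx.1]
  -- Only deleting coordinate `d` contributes: for any other `i`, vectors differing in the sign at
  -- `i` share a facet and cancel.
  rw [Finset.sum_congr rfl hsupp, Finset.sum_comm, Finset.sum_eq_single (⟨d, hd⟩ : Fin m)]
  · refine Finset.sum_nbij' (fun x => update x ⟨d, hd⟩ 0) (fun x => update x ⟨d, hd⟩ 1)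
      ?_ ?_ ?_ ?_ ?_
    · intro x hx
      simp only [mem_filter, mem_initialSigns] at hx ⊢
      intro i
      by_cases h : i = ⟨d, hd⟩
      · simp [h]
      · have := Fin.val_ne_of_ne h
        simp only [update_of_ne h, hx.1]
        simp only at this
        omega
    · intro x hx
      simp only [mem_filter, mem_initialSigns] at hx ⊢
      refine ⟨fun i => ?_, by simp⟩
      by_cases h : i = ⟨d, hd⟩
      · simp [h]
      · have := Fin.val_ne_of_ne h
        simp only [update_of_ne h, hx]
        simp only at this
        omega
    · intro x hx
      simp only [mem_filter] at hx
      simp [← hx.2]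
    · intro x hx
      rw [mem_initialSigns] at hx
      have : x ⟨d, hd⟩ = 0 := by simpa using hx ⟨d, hd⟩
      simp [← this]
    · intro x _; rfl
  · intro i hi hne
    simp only [mem_filter, mem_univ, true_and] at hi
    refine Finset.sum_involution (fun x _ => update x i (-x i)) ?_ ?_ ?_ ?_
    · intro x _
      simpa using CharTwo.add_self_eq_zero _
    · intro x hx _ h
      simp only [mem_filter, mem_initialSigns] at hx
      have h0 := (hx.1 i).2 hi
      have h1 : -x i = x i := by simpa using congrFun h i
      generalize x i = a at h0 h1
      revert a; decide
    · intro x hx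
      simp only [mem_filter, mem_initialSigns] at hx ⊢
      refine ⟨fun j => ?_, by rw [update_of_ne hne.symm, hx.2]⟩
      by_cases h : j = i
      · subst h; simpa using hx.1 j
      · rw [update_of_ne h, hx.1]
    · intro x _
      simp
  · simp

/-- Antipodes pair up over a hemisphere; the coboundary formula turns each pair into a sum over
facets, and these add up to the equator, one dimension lower. -/
lemma sum_altChains_initialSigns {s : (Fin m → SignType) → Bool}
    (hs : ∀ x, x ≠ 0 → s (-x) = !s x) (d : ℕ) (hd : d ≤ m) (b : Bool) :
    ∑ x ∈ initialSigns m d, altChains s d b x = 1 := by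
  induction d with
  | zero =>
    have : initialSigns m 0 = {0} := by
      ext x; simp [mem_initialSigns, funext_iff]
    simp [this, altChains]
  | succ d ih =>
    rw [sum_initialSigns_succ hd, ← ih (by omega), ← sum_hemisphere_sum_update hd]
    refine Finset.sum_congr rfl fun x hx => ?_
    rw [altChains_neg hs _ _ _ (card_signSupport_of_mem_initialSigns hd (mem_filter.1 hx).1),
      altChains_add_altChains_not]

lemma le_of_altChains_ne_zero {s : (Fin m → SignType) → Bool} {r : (Fin m → SignType) → ℕ}
    (hpos : ∀ x, x ≠ 0 → 0 < r x)
    (hr : ∀ x i, x i ≠ 0 → update x i 0 ≠ 0 → s (update x i 0) ≠ s x → r (update x i 0) < r x)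
    (d : ℕ) (b : Bool) (x : Fin m → SignType) (hx : #(signSupport x) = d)
    (h : altChains s d b x ≠ 0) : d ≤ r x := by
  induction d generalizing b x with
  | zero => exact Nat.zero_le _
  | succ d ih =>
    have hx0 : x ≠ 0 := ne_zero_of_card_signSupport_pos (by omega)
    -- The next vector would be zero, where `hr` says nothing.
    rcases Nat.eq_zero_or_pos d with rfl | hd
    · exact hpos x hx0
    simp only [altChains, ne_eq, ite_eq_right_iff, Classical.not_imp] at h
    obtain ⟨hb, h⟩ := h
    obtain ⟨i, hi, hne⟩ := Finset.exists_ne_zero_of_sum_ne_zero h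
    have hcard : #(signSupport (update x i 0)) = d := by
      rw [signSupport_update_zero, card_erase_of_mem hi, hx, Nat.add_sub_cancel]
    have hle := ih _ _ hcard hne
    have hs : s (update x i 0) = !b := by
      obtain ⟨e, rfl⟩ : ∃ e, d = e + 1 := ⟨d - 1, by omega⟩
      by_contra hs
      simp [altChains, hs] at hne
    have := hr x i (mem_signSupport.1 hi)
      (ne_zero_of_card_signSupport_pos (by omega)) (by simp [hs, hb])
    omega

/-- A form of the octahedral Tucker lemma: if `s` is an antipodal labelling of the nonzero sign
vectors, and `r` is a positive rank which strictly increases along each covering pair on which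
`s` changes, then `r` takes a value of at least `m`. -/
theorem exists_le_rank_of_antipodal {s : (Fin m → SignType) → Bool}
    {r : (Fin m → SignType) → ℕ} (hs : ∀ x, x ≠ 0 → s (-x) = !s x)
    (hpos : ∀ x, x ≠ 0 → 0 < r x)
    (hr : ∀ x i, x i ≠ 0 → update x i 0 ≠ 0 → s (update x i 0) ≠ s x → r (update x i 0) < r x) :
    ∃ x, #(signSupport x) = m ∧ m ≤ r x := by
  have h : ∑ x ∈ initialSigns m m, altChains s m true x ≠ 0 := by
    rw [sum_altChains_initialSigns hs m le_rfl]
    exact one_ne_zero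
  obtain ⟨x, hx, hne⟩ := Finset.exists_ne_zero_of_sum_ne_zero h
  have hcard := card_signSupport_of_mem_initialSigns le_rfl hx
  exact ⟨x, hcard, le_of_altChains_ne_zero hpos hr m true x hcard hne⟩

open Classical in
/-- An antipodal labelling of the nonzero sign vectors, by lexicographic comparison of `x`
and `-x`. -/
noncomputable def lexSign (x : Fin m → SignType) : Bool := decide (toLex x < toLex (-x))

lemma lexSign_neg {x : Fin m → SignType} (hx : x ≠ 0) : lexSign (-x) = !lexSign x := by
  have hne : toLex x ≠ toLex (-x) := by
    intro h
    refine hx (funext fun i => ?_)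
    have h1 : x i = -x i := congrFun (toLex_inj.1 h) i
    simp only [Pi.zero_apply]
    generalize x i = a at h1
    revert a; decide
  classical
  unfold lexSign
  rw [neg_neg]
  rw [← decide_not, decide_eq_decide]
  exact ⟨fun h => h.not_gt, fun h => lt_of_le_of_ne (not_lt.1 h) hne.symm⟩

end SignVectors

/-! ### Rank and label from a Kneser colouring -/

section Coloring

variable {n m c : ℕ}

/-- One plus the largest colour of an `n`-set on which `x` is constantly `a`, or zero if there is
no such set. -/
def topColor (C : (kneserGraph n m).Coloring (Fin c)) (a : SignType) (x : Fin m → SignType) : ℕ :=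
  ({t | ∀ i ∈ t.1, x i = a} : Finset {s : Finset (Fin m) // s.card = n}).sup fun t => (C t).val + 1

variable (C : (kneserGraph n m).Coloring (Fin c))

lemma topColor_le (a : SignType) (x : Fin m → SignType) : topColor C a x ≤ c :=
  Finset.sup_le fun t _ => (C t).isLt

lemma topColor_neg (a : SignType) (x : Fin m → SignType) :
    topColor C a (-x) = topColor C (-a) x := by
  unfold topColor
  congr 1
  ext t
  simp [neg_eq_iff_eq_neg]

lemma topColor_update_le {a : SignType} (ha : a ≠ 0) (x : Fin m → SignType) (i : Fin m) :
    topColor C a (update x i 0) ≤ topColor C a x := by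
  refine Finset.sup_mono fun t ht => ?_
  simp only [mem_filter, mem_univ, true_and] at ht ⊢
  intro j hj
  have := ht j hj
  by_cases h : j = i
  · simp [h, ha.symm] at this
  · rwa [update_of_ne h] at this

lemma topColor_pos {a : SignType} {x : Fin m → SignType}
    (h : n ≤ #{i | x i = a}) : 0 < topColor C a x := by
  obtain ⟨t, ht, hcard⟩ := Finset.exists_subset_card_eq h
  refine lt_of_lt_of_le (Nat.succ_pos (C ⟨t, hcard⟩).val)
    (Finset.le_sup (f := fun t => (C t).val + 1) (b := ⟨t, hcard⟩) ?_)
  simp only [mem_filter, mem_univ, true_and]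
  exact fun i hi => by simpa using ht hi

lemma exists_of_topColor_pos {a : SignType} {x : Fin m → SignType} (h : 0 < topColor C a x) :
    ∃ t : {s : Finset (Fin m) // s.card = n}, (∀ i ∈ t.1, x i = a) ∧
      topColor C a x = (C t).val + 1 := by
  have hne : ({t | ∀ i ∈ t.1, x i = a} : Finset {s : Finset (Fin m) // s.card = n}).Nonempty := by
    by_contra hne
    rw [Finset.not_nonempty_iff_eq_empty] at hne
    simp [topColor, hne] at h
  obtain ⟨t, ht, heq⟩ := Finset.exists_mem_eq_sup _ hne fun t => (C t).val + 1
  exact ⟨t, by simpa using ht, heq⟩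

/-- Sets on which `x` takes opposite signs are disjoint, hence adjacent and differently coloured. -/
lemma topColor_ne (hn : 1 ≤ n) {x : Fin m → SignType} (h : 0 < topColor C 1 x) :
    topColor C 1 x ≠ topColor C (-1) x := by
  intro heq
  obtain ⟨t, ht, hct⟩ := exists_of_topColor_pos C h
  obtain ⟨u, hu, hcu⟩ := exists_of_topColor_pos C (heq ▸ h)
  have hdisj : Disjoint t.1 u.1 := Finset.disjoint_left.2 fun i hi hi' => by
    have := (ht i hi).symm.trans (hu i hi')
    revert this; decide
  refine C.valid (v := t) (w := u) ⟨?_, hdisj⟩ (Fin.ext (by omega))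
  rintro rfl
  have := t.2
  rw [disjoint_self.1 hdisj] at this
  simp at this
  omega

/-- By pigeonhole some sign occurs at least `n` times, so the two values are not both zero. -/
lemma topColor_one_ne_topColor_neg_one (hn : 1 ≤ n) {x : Fin m → SignType}
    (hx : 2 * n - 2 < #(signSupport x)) : topColor C 1 x ≠ topColor C (-1) x := by
  rcases Nat.eq_zero_or_pos (topColor C 1 x) with h | h
  · have hunion : signSupport x = ({i | x i = 1} : Finset (Fin m)) ∪ ({i | x i = -1} : Finset (Fin m)) := by
      ext i
      simp only [mem_signSupport, mem_union, mem_filter, mem_univ, true_and]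
      generalize x i = a
      revert a; decide
    have hcard := Finset.card_union_le ({i | x i = 1} : Finset (Fin m)) {i | x i = -1}
    rw [← hunion] at hcard
    have h1 : ¬ n ≤ #{i | x i = 1} := fun h' => (topColor_pos C h').ne' h
    have h2 : n ≤ #{i | x i = -1} := by omega
    have := topColor_pos C h2
    omega
  · exact topColor_ne C hn h

/-- The rank of a sign vector: the size of its support if that is at most `2n - 2`, and otherwise
`2n - 2` plus the largest colour of an `n`-set on which it is a nonzero constant. -/
def kneserRank (x : Fin m → SignType) : ℕ :=
  if #(signSupport x) ≤ 2 * n - 2 then #(signSupport x)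
  else 2 * n - 2 + max (topColor C 1 x) (topColor C (-1) x)

/-- The antipodal labelling of sign vectors that goes with `kneserRank`: large vectors are
labelled by the sign of the `n`-set that determines the rank. -/
noncomputable def kneserSign (x : Fin m → SignType) : Bool :=
  if #(signSupport x) ≤ 2 * n - 2 then lexSign x
  else decide (topColor C (-1) x < topColor C 1 x)

lemma kneserSign_neg (hn : 1 ≤ n) {x : Fin m → SignType} (hx : x ≠ 0) :
    kneserSign C (-x) = !kneserSign C x := by
  unfold kneserSign
  rw [signSupport_neg]
  split_ifs with h
  · exact lexSign_neg hx
  · have hne := topColor_one_ne_topColor_neg_one C hn (not_le.1 h)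
    rw [topColor_neg, topColor_neg, neg_neg]
    rcases lt_or_gt_of_ne hne with h | h <;> simp [h, h.le]

lemma kneserRank_pos (hn : 1 ≤ n) {x : Fin m → SignType} (hx : x ≠ 0) : 0 < kneserRank C x := by
  unfold kneserRank
  split_ifs with h
  · obtain ⟨i, hi⟩ := Function.ne_iff.1 hx
    exact Finset.card_pos.2 ⟨i, mem_signSupport.2 hi⟩
  · have := topColor_one_ne_topColor_neg_one C hn (not_le.1 h)
    omega

lemma kneserRank_update_lt (hn : 1 ≤ n) {x : Fin m → SignType} {i : Fin m} (hi : x i ≠ 0)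
    (hs : kneserSign C (update x i 0) ≠ kneserSign C x) :
    kneserRank C (update x i 0) < kneserRank C x := by
  have hcard : #(signSupport (update x i 0)) + 1 = #(signSupport x) := by
    rw [signSupport_update_zero]
    exact card_erase_add_one (mem_signSupport.2 hi)
  have h1 := topColor_update_le C (a := 1) (by decide) x i
  have h2 := topColor_update_le C (a := -1) (by decide) x i
  unfold kneserRank
  unfold kneserSign at hs
  by_cases hx : #(signSupport x) ≤ 2 * n - 2
  · rw [if_pos hx, if_pos (by omega)]
    omega
  have hxne := topColor_one_ne_topColor_neg_one C hn (not_le.1 hx)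
  rw [if_neg hx]
  by_cases hy : #(signSupport (update x i 0)) ≤ 2 * n - 2
  · rw [if_pos hy]
    omega
  -- The maxima before and after deletion sit on opposite signs; by monotonicity the new winner at
  -- `x` beats the old one.
  · have hyne := topColor_one_ne_topColor_neg_one C hn (not_le.1 hy)
    rw [if_neg hy, if_neg hx, ne_eq, decide_eq_decide] at hs
    rw [if_neg hy]
    omega

/-- The number of colours of a proper colouring of `KG(n, m)` is at least `m - (2n - 2)`. -/
theorem le_add_of_kneserGraph_coloring (C : (kneserGraph n m).Coloring (Fin c)) (hn : 1 ≤ n)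
    (hm : 2 * n - 2 < m) : m ≤ 2 * n - 2 + c := by
  obtain ⟨x, hx, hle⟩ := exists_le_rank_of_antipodal (s := kneserSign C) (r := kneserRank C)
    (fun _ => kneserSign_neg C hn) (fun _ => kneserRank_pos C hn)
    (fun _ _ hi _ => kneserRank_update_lt C hn hi)
  rw [kneserRank, if_neg (by omega)] at hle
  have h1 := topColor_le C 1 x
  have h2 := topColor_le C (-1) x
  omega

end Coloring

theorem theorem3p2 (n k : ℕ) (hn : 1 ≤ n) :
    ((k + 2 : ℕ) : ℕ∞) ≤ (kneserGraph n (2 * n + k)).chromaticNumber := by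
  refine SimpleGraph.le_chromaticNumber_iff_colorable.2 fun c hc => ?_
  obtain ⟨C⟩ := hc
  have := le_add_of_kneserGraph_coloring C hn (by omega)
  exact_mod_cast (by omega : k + 2 ≤ c)
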